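/- Let $\mathcal{D}_n$ be the set of $n \times n$ complex density matrices (positive semidefinite matrices of trace $1$) and, for an integer $1 \leq k \leq n$, let $\mathcal{D}_{n,k} \subseteq \mathcal{D}_n$ be the set of density matrices of rank at most $k$. Let $\|\cdot\|$ be a unitary similarity invariant norm on the $n \times n$ complex matrices, i.e. a norm such that $\|U^*XU\| = \|X\|$ for every matrix $X$ and every unitary matrix $U$, and write $$d(X,\mathcal{D}_{n,k}) = \min_{Y \in \mathcal{D}_{n,k}} \|X - Y\|.$$ If $1 \leq k \leq n$, $k \geq n-1$ and $X \in \mathcal{D}_n$, then $$d(X,\mathcal{D}_{n,k}) \leq d\big(\tfrac{1}{n} I_n, \mathcal{D}_{n,k}\big).$$ -/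

import Mathlib

open scoped Matrix ComplexOrder

/-- The set `𝓓ₙ` of density matrices: complex positive semidefinite `n × n` matrices of trace one. -/
def densityMatrices (n : ℕ) : Set (Matrix (Fin n) (Fin n) ℂ) :=
  {X | X.PosSemidef ∧ X.trace = 1}

/-- The set `𝓓ₙ,ₖ` of density matrices of rank at most `k`. -/
def lowRankDensityMatrices (n k : ℕ) : Set (Matrix (Fin n) (Fin n) ℂ) :=
  {X | X ∈ densityMatrices n ∧ X.rank ≤ k}

/-- The maximally mixed state `(1/n) Iₙ`. -/
noncomputable def maximallyMixed (n : ℕ) : Matrix (Fin n) (Fin n) ℂ :=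
  (1 / (n : ℂ)) • (1 : Matrix (Fin n) (Fin n) ℂ)

/-- A unitary similarity invariant norm on the complex vector space of `n × n` complex matrices:
a definite seminorm `N` with `N (U* X U) = N X` for all `X` and all unitary `U`. -/
structure USINorm (n : ℕ) extends Seminorm ℂ (Matrix (Fin n) (Fin n) ℂ) where
  definite : ∀ X : Matrix (Fin n) (Fin n) ℂ, toSeminorm X = 0 → X = 0
  unitary_similarity_invariant : ∀ X : Matrix (Fin n) (Fin n) ℂ,
    ∀ U ∈ Matrix.unitaryGroup (Fin n) ℂ, toSeminorm (Uᴴ * X * U) = toSeminorm X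

/-- The distance `d(X, 𝓓ₙ,ₖ) = min {‖X - Y‖ : Y ∈ 𝓓ₙ,ₖ}`. That this infimum is a minimum
whenever `1 ≤ k` and `1 ≤ n` is `lowRankDist_isLeast` below. -/
noncomputable def lowRankDist {n : ℕ} (N : USINorm n) (k : ℕ)
    (X : Matrix (Fin n) (Fin n) ℂ) : ℝ :=
  sInf ((fun Y => N.toSeminorm (X - Y)) '' lowRankDensityMatrices n k)

/-- For `1 ≤ n` the maximally mixed state is a density matrix. -/
theorem maximallyMixed_mem {n : ℕ} (hn : 1 ≤ n) : maximallyMixed n ∈ densityMatrices n := by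
  refine ⟨Matrix.PosSemidef.one.smul (by positivity), ?_⟩
  have : (n : ℂ) ≠ 0 := by exact_mod_cast (by omega : n ≠ 0)
  simp [maximallyMixed, Matrix.trace_smul, this]

theorem lowRankDensityMatrices_nonempty {n k : ℕ} (hn : 1 ≤ n) (hk : 1 ≤ k) :
    (lowRankDensityMatrices n k).Nonempty := by
  have i : Fin n := ⟨0, hn⟩
  refine ⟨Matrix.diagonal (Pi.single i 1), ⟨Matrix.PosSemidef.diagonal ?_, ?_⟩, ?_⟩
  · exact Pi.single_nonneg.2 zero_le_one
  · simp [Matrix.trace_diagonal]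
  · rw [Matrix.rank_diagonal, Fintype.card_subtype]
    refine le_trans (Finset.card_le_card (t := {i}) ?_) (by simpa using hk)
    intro j hj
    by_contra h
    simp_all [Pi.single_apply]

theorem norm_entry_le_one {n : ℕ} {Y : Matrix (Fin n) (Fin n) ℂ} (hY : Y ∈ densityMatrices n)
    (i j : Fin n) : ‖Y i j‖ ≤ 1 := by
  obtain ⟨hp, ht⟩ := hY
  have hre : ∀ l, 0 ≤ (Y l l).re ∧ (Y l l).im = 0 := fun l => by
    have := Complex.le_def.1 (hp.diag_nonneg (i := l))
    exact ⟨by simpa using this.1, by simpa using this.2.symm⟩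
  have hsum : ∑ l, (Y l l).re = 1 := by
    have := congrArg Complex.re ht
    simpa [Matrix.trace] using this
  have hle : ∀ l, (Y l l).re ≤ 1 := fun l => by
    rw [← hsum]
    exact Finset.single_le_sum (f := fun l => (Y l l).re) (fun l _ => (hre l).1)
      (Finset.mem_univ l)
  have hd := (hp.submatrix ![i, j]).det_nonneg
  rw [Matrix.det_fin_two] at hd
  have hij : Y j i = star (Y i j) := (hp.1.apply j i).symm
  simp only [Matrix.submatrix_apply, Matrix.cons_val_zero, Matrix.cons_val_one, hij] at hd
  have h2 := (Complex.le_def.1 hd).1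
  simp only [Complex.zero_re, Complex.sub_re, Complex.mul_re, (hre i).2, (hre j).2,
    Complex.star_def, Complex.conj_re, Complex.conj_im] at h2
  have h3 : ‖Y i j‖ ^ 2 ≤ 1 := by
    rw [← Complex.normSq_eq_norm_sq, Complex.normSq_apply]
    nlinarith [hre i, hre j, hle i, hle j]
  nlinarith [norm_nonneg (Y i j)]

theorem USINorm.continuous {n : ℕ} (N : USINorm n) : Continuous N.toSeminorm := by
  refine Seminorm.continuous_of_continuousAt_zero ?_
  have hs : ∀ f : Fin n → Matrix (Fin n) (Fin n) ℂ,
      N.toSeminorm (∑ i, f i) ≤ ∑ i, N.toSeminorm (f i) := fun f =>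
    Finset.le_sum_of_subadditive N.toSeminorm (map_zero _).le (map_add_le_add _) _ f
  have hb : ∀ X : Matrix (Fin n) (Fin n) ℂ, N.toSeminorm X ≤
      ∑ i, ∑ j, ‖X i j‖ * N.toSeminorm (Matrix.single i j 1) := fun X => by
    conv_lhs => rw [Matrix.matrix_eq_sum_single X]
    refine (hs _).trans (Finset.sum_le_sum fun i _ =>
      (hs _).trans (Finset.sum_le_sum fun j _ => ?_))
    rw [← map_smul_eq_mul, Matrix.smul_single, smul_eq_mul, mul_one]
  have hc : Continuous fun X : Matrix (Fin n) (Fin n) ℂ =>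
      ∑ i, ∑ j, ‖X i j‖ * N.toSeminorm (Matrix.single i j 1) := by
    fun_prop
  have h0 := hc.tendsto 0
  simp only [Matrix.zero_apply, norm_zero, zero_mul, Finset.sum_const_zero] at h0
  rw [ContinuousAt, map_zero]
  exact tendsto_of_tendsto_of_tendsto_of_le_of_le tendsto_const_nhds h0
    (fun X => apply_nonneg _ X) hb

theorem isClosed_rank_le (n k : ℕ) : IsClosed {X : Matrix (Fin n) (Fin n) ℂ | X.rank ≤ k} := by
  let L : Matrix (Fin n) (Fin n) ℂ →ₗ[ℂ] ((Fin n → ℂ) →L[ℂ] (Fin n → ℂ)) :=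
    (LinearMap.toContinuousLinearMap.toLinearMap).comp (Matrix.toLin').toLinearMap
  have hL : Continuous L := L.continuous_of_finiteDimensional
  have ho := (isOpen_setOfPred_nat_le_rank (𝕜 := ℂ) (E := Fin n → ℂ) (F := Fin n → ℂ)
    (k + 1)).preimage hL
  rw [← isOpen_compl_iff]
  convert ho using 1
  ext X
  have : ((L X : (Fin n → ℂ) →L[ℂ] (Fin n → ℂ)) : (Fin n → ℂ) →ₗ[ℂ] (Fin n → ℂ)).rank
      = (X.rank : Cardinal) := by
    rw [Matrix.rank, Module.finrank_eq_rank]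
    rfl
  simp only [Set.mem_compl_iff, Set.mem_ofPred_eq, Set.mem_preimage, this]
  norm_cast
  omega

theorem isCompact_lowRankDensityMatrices (n k : ℕ) :
    IsCompact (lowRankDensityMatrices n k) := by
  have hK : IsCompact {X : Matrix (Fin n) (Fin n) ℂ | ∀ i j, X i j ∈ Metric.closedBall (0 : ℂ) 1} := by
    have := isCompact_univ_pi (X := fun _ : Fin n => Fin n → ℂ) fun _ =>
      isCompact_univ_pi (X := fun _ : Fin n => ℂ) fun _ => isCompact_closedBall (0 : ℂ) 1
    have he : {X : Fin n → Fin n → ℂ | ∀ i j, X i j ∈ Metric.closedBall (0 : ℂ) 1} =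
        Set.pi Set.univ fun _ => Set.pi Set.univ fun _ => Metric.closedBall (0 : ℂ) 1 := by
      ext X
      simp [Set.mem_pi]
    rw [← he] at this
    exact this
  refine hK.of_isClosed_subset ?_ fun X hX i j => by
    simpa using norm_entry_le_one hX.1 i j
  have hp : IsClosed {X : Matrix (Fin n) (Fin n) ℂ | X.PosSemidef} := by
    simp only [Matrix.posSemidef_iff_dotProduct_mulVec, Matrix.IsHermitian]
    refine IsClosed.inter (isClosed_eq (by fun_prop) continuous_id) ?_
    have he : {X : Matrix (Fin n) (Fin n) ℂ | ∀ x : Fin n → ℂ, 0 ≤ star x ⬝ᵥ (X *ᵥ x)} =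
        ⋂ x : Fin n → ℂ, {X | 0 ≤ star x ⬝ᵥ (X *ᵥ x)} := by
      ext X
      simp
    have hcl : IsClosed {X : Matrix (Fin n) (Fin n) ℂ | ∀ x : Fin n → ℂ, 0 ≤ star x ⬝ᵥ (X *ᵥ x)} := by
      rw [he]
      exact isClosed_iInter fun x => isClosed_le continuous_const (by fun_prop)
    exact hcl
  have ht : IsClosed {X : Matrix (Fin n) (Fin n) ℂ | X.trace = 1} :=
    isClosed_eq (by fun_prop) continuous_const
  exact (hp.inter ht).inter (isClosed_rank_le n k)

/-- The infimum in the definition of `lowRankDist` is attained. -/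
theorem lowRankDist_isLeast {n k : ℕ} (hn : 1 ≤ n) (hk : 1 ≤ k) (N : USINorm n)
    (X : Matrix (Fin n) (Fin n) ℂ) :
    IsLeast ((fun Y => N.toSeminorm (X - Y)) '' lowRankDensityMatrices n k)
      (lowRankDist N k X) := by
  have hc : Continuous fun Y => N.toSeminorm (X - Y) :=
    N.continuous.comp (continuous_const.sub continuous_id)
  exact ((isCompact_lowRankDensityMatrices n k).image hc).isLeast_sInf
    ((lowRankDensityMatrices_nonempty hn hk).image _)

/-! If `k = n`, the left side is zero. Otherwise `k = n - 1` and `n ≥ 2`; both distances are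
compared with `N(s) / n`, where `s` is the diagonal matrix of a spike, whose norm does not depend on
its position. Lower bound (`USINorm.tracelessSpike_le_maximallyMixed_sub`): a singular density
matrix `Z` has a zero eigenvalue, so `I/n - Z` is unitarily similar to a traceless diagonal matrix
with an entry `1/n`. Averaging over the permutations that fix this entry yields `s / n` and cannot
increase the norm. Upper bound (`exists_lowRank_sub_le`): the least eigenvalue of `X` is at most
`1/n`; moving it evenly onto the other eigenvalues changes `X` by that multiple of a conjugate of
`s`. -/

/-- The traceless vector with entry `1` at `j` and all other entries equal. -/
noncomputable def tracelessSpike {n : ℕ} (j : Fin n) : Fin n → ℂ :=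
  fun i => if i = j then 1 else -((n : ℂ) - 1)⁻¹

/-- Permuting the entries of a diagonal matrix does not change a unitary similarity invariant
norm. -/
theorem USINorm.diagonal_comp_perm {n : ℕ} (N : USINorm n) (d : Fin n → ℂ)
    (σ : Equiv.Perm (Fin n)) :
    N.toSeminorm (Matrix.diagonal (d ∘ σ)) = N.toSeminorm (Matrix.diagonal d) := by
  -- Invariance is stated for `Uᴴ * X * U`, so the inverse is taken to make `Uᴴ` the permutation
  -- matrix of `σ`.
  have hU : (σ⁻¹).permMatrix ℂ ∈ Matrix.unitaryGroup (Fin n) ℂ := by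
    rw [Matrix.mem_unitaryGroup_iff, Matrix.star_eq_conjTranspose, Matrix.conjTranspose_permMatrix,
      ← Matrix.permMatrix_mul]
    simp
  rw [← N.unitary_similarity_invariant (Matrix.diagonal d) _ hU]
  congr 1
  rw [Matrix.conjTranspose_permMatrix, inv_inv, PEquiv.toMatrix_toPEquiv_mul,
    PEquiv.mul_toMatrix_toPEquiv]
  ext a b
  have hσ : σ a = (Equiv.symm σ⁻¹) b ↔ a = b := σ.injective.eq_iff
  simp [Matrix.diagonal_apply, hσ]

/-- Conjugating by a unitary on the other side does not change the norm either. -/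
theorem USINorm.unitary_conj {n : ℕ} (N : USINorm n) (U : Matrix.unitaryGroup (Fin n) ℂ)
    (A : Matrix (Fin n) (Fin n) ℂ) :
    N.toSeminorm ((U : Matrix (Fin n) (Fin n) ℂ) * A * (U : Matrix (Fin n) (Fin n) ℂ)ᴴ) =
      N.toSeminorm A := by
  have h := N.unitary_similarity_invariant A _ (star U).2
  simpa [Matrix.star_eq_conjTranspose] using h

/-- Needed because the zero eigenvalue in the lower bound and the least eigenvalue in the upper
bound may sit at different indices. -/
theorem USINorm.tracelessSpike_eq {n : ℕ} (N : USINorm n) (i j : Fin n) :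
    N.toSeminorm (Matrix.diagonal (tracelessSpike i)) =
      N.toSeminorm (Matrix.diagonal (tracelessSpike j)) := by
  rw [← N.diagonal_comp_perm (tracelessSpike j) (Equiv.swap i j)]
  congr 2
  ext l
  simp only [tracelessSpike, Function.comp_apply]
  congr 1
  rw [Equiv.swap_apply_eq_iff, Equiv.swap_apply_right]

/-- Averaging a vector with zero sum over the stabilizer of `j` gives a multiple of
`tracelessSpike j`. -/
theorem sum_stabilizer_apply {n : ℕ} (hn : 2 ≤ n) (d : Fin n → ℂ) (hd : ∑ i, d i = 0)
    (j i : Fin n) :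
    ∑ σ : Equiv.Perm (Fin n) with σ j = j, d (σ i) =
      ((Finset.univ.filter fun σ : Equiv.Perm (Fin n) => σ j = j).card : ℂ) *
        (d j * tracelessSpike j i) := by
  set S := Finset.univ.filter fun σ : Equiv.Perm (Fin n) => σ j = j with hS
  have hj : ∑ σ ∈ S, d (σ j) = S.card * d j := by
    rw [Finset.sum_congr rfl fun σ hσ => by rw [(Finset.mem_filter.1 hσ).2]]
    simp
  by_cases hij : i = j
  · subst hij
    simp [hj, tracelessSpike]
  -- The transposition of `l` and `i` fixes `j`, so right multiplication by it permutes the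
  -- stabilizer.
  have hconst : ∀ l, l ≠ j → ∑ σ ∈ S, d (σ l) = ∑ σ ∈ S, d (σ i) := fun l hl => by
    refine Finset.sum_bij' (fun σ _ => σ * Equiv.swap l i) (fun σ _ => σ * Equiv.swap l i)
      ?_ ?_ ?_ ?_ ?_
    · intro σ hσ
      simpa [hS, Equiv.swap_apply_of_ne_of_ne hl.symm (Ne.symm hij)] using hσ
    · intro σ hσ
      simpa [hS, Equiv.swap_apply_of_ne_of_ne hl.symm (Ne.symm hij)] using hσ
    · simp [mul_assoc]
    · simp [mul_assoc]
    · simp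
  -- The zero total determines the common value at the `n - 1` indices other than `j`.
  have htot : ∑ l, ∑ σ ∈ S, d (σ l) = 0 := by
    rw [Finset.sum_comm]
    exact Finset.sum_eq_zero fun σ _ => (Equiv.sum_comp σ d).trans hd
  rw [← Finset.add_sum_erase _ _ (Finset.mem_univ j), hj,
    Finset.sum_congr rfl fun l hl => hconst l (Finset.ne_of_mem_erase hl), Finset.sum_const,
    Finset.card_erase_of_mem (Finset.mem_univ j), Finset.card_univ, Fintype.card_fin,
    nsmul_eq_mul, Nat.cast_sub (by omega)] at htot
  have hn' : (n : ℂ) - 1 ≠ 0 := by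
    rw [sub_ne_zero]
    exact_mod_cast (by omega : n ≠ 1)
  simp only [tracelessSpike, if_neg hij]
  push_cast at htot
  field_simp
  linear_combination htot

/-- Triangle inequality for the average over the stabilizer of `j`, all of whose terms have the norm
of `diagonal d`. -/
theorem USINorm.tracelessSpike_le {n : ℕ} (hn : 2 ≤ n) (N : USINorm n) (d : Fin n → ℂ)
    (hd : ∑ i, d i = 0) (j : Fin n) :
    ‖d j‖ * N.toSeminorm (Matrix.diagonal (tracelessSpike j)) ≤
      N.toSeminorm (Matrix.diagonal d) := by
  set S := Finset.univ.filter fun σ : Equiv.Perm (Fin n) => σ j = j with hS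
  have hpos : (0 : ℝ) < S.card := by
    exact_mod_cast Finset.card_pos.2 ⟨1, by simp [hS]⟩
  have heq : ∑ σ ∈ S, Matrix.diagonal (d ∘ σ) =
      ((S.card : ℂ) * d j) • Matrix.diagonal (tracelessSpike j) := by
    ext a b
    rw [Matrix.sum_apply]
    by_cases hab : a = b
    · subst hab
      simpa [mul_assoc] using sum_stabilizer_apply hn d hd j a
    · simp [hab]
  have hle : N.toSeminorm (∑ σ ∈ S, Matrix.diagonal (d ∘ σ)) ≤
      ∑ σ ∈ S, N.toSeminorm (Matrix.diagonal (d ∘ σ)) :=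
    Finset.le_sum_of_subadditive N.toSeminorm (map_zero _).le (map_add_le_add _) _ _
  rw [heq, map_smul_eq_mul, norm_mul, Complex.norm_natCast] at hle
  simp only [N.diagonal_comp_perm, Finset.sum_const, nsmul_eq_mul, mul_assoc] at hle
  exact le_of_mul_le_mul_left hle hpos

/-- A density matrix is unitarily similar to the diagonal matrix of a probability vector. -/
theorem exists_unitary_diagonal {n : ℕ} {X : Matrix (Fin n) (Fin n) ℂ}
    (hX : X ∈ densityMatrices n) :
    ∃ (U : Matrix.unitaryGroup (Fin n) ℂ) (x : Fin n → ℝ), (∀ i, 0 ≤ x i) ∧ ∑ i, x i = 1 ∧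
      X = (U : Matrix (Fin n) (Fin n) ℂ) * Matrix.diagonal (fun i => (x i : ℂ)) *
        (U : Matrix (Fin n) (Fin n) ℂ)ᴴ ∧ X.rank = Fintype.card {i // x i ≠ 0} := by
  obtain ⟨hp, ht⟩ := hX
  refine ⟨hp.1.eigenvectorUnitary, hp.1.eigenvalues, hp.eigenvalues_nonneg, ?_, ?_,
    hp.1.rank_eq_card_non_zero_eigs⟩
  · have := hp.1.trace_eq_sum_eigenvalues
    rw [ht] at this
    exact Complex.ofReal_injective (by simpa using this.symm)
  · conv_lhs => rw [hp.1.spectral_theorem, Unitary.conjStarAlgAut_apply]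
    rfl

theorem sub_unitary_diagonal_eq {n : ℕ} (U : Matrix.unitaryGroup (Fin n) ℂ) (c : ℂ)
    (z : Fin n → ℂ) :
    c • (1 : Matrix (Fin n) (Fin n) ℂ) - (U : Matrix (Fin n) (Fin n) ℂ) * Matrix.diagonal z *
        (U : Matrix (Fin n) (Fin n) ℂ)ᴴ =
      (U : Matrix (Fin n) (Fin n) ℂ) * Matrix.diagonal (fun i => c - z i) *
        (U : Matrix (Fin n) (Fin n) ℂ)ᴴ := by
  have hU : (U : Matrix (Fin n) (Fin n) ℂ) * (U : Matrix (Fin n) (Fin n) ℂ)ᴴ = 1 :=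
    Unitary.coe_mul_star_self U
  have h1 : Matrix.diagonal (fun i => c - z i) = c • 1 - Matrix.diagonal z := by
    rw [Matrix.smul_one_eq_diagonal, Matrix.diagonal_sub]
  rw [h1, mul_sub, sub_mul, mul_smul_comm, smul_mul_assoc, mul_one, hU]

/-- Lower bound for the distance of the maximally mixed state from a singular density matrix. -/
theorem USINorm.tracelessSpike_le_maximallyMixed_sub {n k : ℕ} (hn : 2 ≤ n) (hk : k < n)
    (N : USINorm n) {Z : Matrix (Fin n) (Fin n) ℂ} (hZ : Z ∈ lowRankDensityMatrices n k)
    (i : Fin n) :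
    1 / (n : ℝ) * N.toSeminorm (Matrix.diagonal (tracelessSpike i)) ≤
      N.toSeminorm (maximallyMixed n - Z) := by
  obtain ⟨U, z, -, hz1, hZU, hr⟩ := exists_unitary_diagonal hZ.1
  obtain ⟨j, hj⟩ : ∃ j, z j = 0 := by
    by_contra! h
    have hrk := hZ.2
    rw [hr, Fintype.card_subtype, Finset.filter_true_of_mem fun i _ => h i] at hrk
    simp at hrk
    omega
  have hn0 : (n : ℂ) ≠ 0 := by exact_mod_cast (by omega : n ≠ 0)
  have hsum : ∑ i, (1 / (n : ℂ) - z i) = 0 := by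
    rw [Finset.sum_sub_distrib, ← Complex.ofReal_sum, hz1]
    simp [hn0]
  -- Since `z j = 0`, the entry at `j` is exactly `1 / n`.
  have h := N.tracelessSpike_le hn _ hsum j
  rw [hZU, maximallyMixed, sub_unitary_diagonal_eq, N.unitary_conj, N.tracelessSpike_eq i j]
  simpa [hj] using h

/-- Spreading the smallest eigenvalue of a density matrix over the other ones gives a singular
density matrix nearby. -/
theorem exists_lowRank_sub_le {n k : ℕ} (hn : 2 ≤ n) (hk : n - 1 ≤ k) (N : USINorm n)
    {X : Matrix (Fin n) (Fin n) ℂ} (hX : X ∈ densityMatrices n) (i : Fin n) :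
    ∃ Y ∈ lowRankDensityMatrices n k, N.toSeminorm (X - Y) ≤
      1 / (n : ℝ) * N.toSeminorm (Matrix.diagonal (tracelessSpike i)) := by
  obtain ⟨U, x, hx0, hx1, hXU, -⟩ := exists_unitary_diagonal hX
  have : Nonempty (Fin n) := ⟨i⟩
  obtain ⟨j, hj⟩ := Finite.exists_min x
  have hn0 : (0 : ℝ) < n := by exact_mod_cast (by omega : 0 < n)
  have hn1 : (0 : ℝ) < (n : ℝ) - 1 := by
    rw [sub_pos]
    exact_mod_cast (by omega : 1 < n)
  -- The minimum is at most the mean.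
  have hxj : x j ≤ 1 / n := by
    rw [le_div_iff₀ hn0, mul_comm, ← hx1]
    simpa using Finset.card_nsmul_le_sum Finset.univ x (x j) fun l _ => hj l
  -- Chosen so that `x - y` is `x j` times the spike at `j`.
  let y : Fin n → ℝ := fun l => if l = j then 0 else x l + x j * ((n : ℝ) - 1)⁻¹
  have hy0 : ∀ l, 0 ≤ y l := fun l => by
    dsimp only [y]
    split_ifs
    · exact le_rfl
    · exact add_nonneg (hx0 l) (mul_nonneg (hx0 j) (inv_pos.2 hn1).le)
  have hy1 : ∑ l, y l = 1 := by
    rw [← Finset.add_sum_erase _ _ (Finset.mem_univ j)]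
    rw [← Finset.add_sum_erase _ _ (Finset.mem_univ j)] at hx1
    rw [Finset.sum_congr rfl fun l hl => if_neg (Finset.ne_of_mem_erase hl),
      Finset.sum_add_distrib, Finset.sum_const, Finset.card_erase_of_mem (Finset.mem_univ j),
      Finset.card_univ, Fintype.card_fin, nsmul_eq_mul, Nat.cast_sub (by omega)]
    simp only [y, if_true, Nat.cast_one]
    field_simp
    linarith
  have hUU : (U : Matrix (Fin n) (Fin n) ℂ)ᴴ * (U : Matrix (Fin n) (Fin n) ℂ) = 1 :=
    Unitary.coe_star_mul_self U
  refine ⟨(U : Matrix (Fin n) (Fin n) ℂ) * Matrix.diagonal (fun i => (y i : ℂ)) *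
        (U : Matrix (Fin n) (Fin n) ℂ)ᴴ, ⟨⟨?_, ?_⟩, ?_⟩, ?_⟩
  · refine Matrix.PosSemidef.mul_mul_conjTranspose_same (Matrix.PosSemidef.diagonal fun l => ?_) _
    simpa using hy0 l
  · rw [Matrix.trace_mul_comm, ← mul_assoc, hUU, one_mul, Matrix.trace_diagonal,
      ← Complex.ofReal_sum, hy1, Complex.ofReal_one]
  · refine (Matrix.rank_mul_le_left _ _).trans ((Matrix.rank_mul_le_right _ _).trans ?_)
    rw [Matrix.rank_diagonal, Fintype.card_subtype]
    refine le_trans (Finset.card_le_card (t := Finset.univ.erase j) fun l hl => ?_) ?_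
    · refine Finset.mem_erase.2 ⟨?_, Finset.mem_univ l⟩
      rintro rfl
      simp [y] at hl
    · simpa [Finset.card_erase_of_mem] using hk
  · have hd : Matrix.diagonal (fun l => (x l : ℂ)) - Matrix.diagonal (fun l => (y l : ℂ)) =
        (x j : ℂ) • Matrix.diagonal (tracelessSpike j) := by
      rw [Matrix.diagonal_sub, ← Matrix.diagonal_smul]
      congr 1
      ext l
      by_cases hl : l = j
      · simp [y, hl, tracelessSpike]
      · simp [y, hl, tracelessSpike]
    rw [hXU, ← sub_mul, ← mul_sub, N.unitary_conj, hd, map_smul_eq_mul, Complex.norm_real,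
      Real.norm_of_nonneg (hx0 j), N.tracelessSpike_eq j i]
    exact mul_le_mul_of_nonneg_right hxj (apply_nonneg _ _)

theorem corollary5 (n k : ℕ) (hk : 1 ≤ k) (hkn : k ≤ n) (hnk : (n : ℤ) - 1 ≤ (k : ℤ))
    (N : USINorm n) (X : Matrix (Fin n) (Fin n) ℂ) (hX : X ∈ densityMatrices n) :
    lowRankDist N k X ≤ lowRankDist N k (maximallyMixed n) := by
  have hn : 1 ≤ n := hk.trans hkn
  obtain ⟨Z, hZ, hZd⟩ := (lowRankDist_isLeast hn hk N (maximallyMixed n)).1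
  have hmin := (lowRankDist_isLeast hn hk N X).2
  rw [← hZd]
  obtain rfl | hlt := hkn.eq_or_lt
  -- With `k = n` the rank condition is vacuous, so `X` competes with itself.
  · have h0 := hmin ⟨X, ⟨hX, by simpa using X.rank_le_card_width⟩, rfl⟩
    simp only [sub_self, map_zero] at h0
    exact h0.trans (apply_nonneg _ _)
  · obtain ⟨Y, hY, hYd⟩ :=
      exists_lowRank_sub_le (k := k) (by omega) (by omega) N hX ⟨0, hn⟩
    exact (hmin ⟨Y, hY, rfl⟩).trans
      (hYd.trans (N.tracelessSpike_le_maximallyMixed_sub (by omega) hlt hZ ⟨0, hn⟩))
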